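/- Let $U\ge 1$ be an integer, $\rho>1$ and $p\in(1/2,1]$. Let $X=(X_n^u)_{n\ge1,\,1\le u\le U}$ be i.i.d. random variables with $\mathbb P[X_n^u=1]=p=1-\mathbb P[X_n^u=-1]$, and let $V=(V_n^u)_{n\ge1,\,1\le u\le U}$ be i.i.d. random variables, uniform on $[0,1]$, with the family $V$ independent of the family $X$. Put $w_i=\rho^i$ and $\pi(i,j)=\dfrac{w_i}{w_i+w_j}$ for integers $i,j\ge0$. Consider $U$ urns, all empty at time $0$. At each time $n\ge1$ one ball, black or white, is added to every urn, simultaneously for all urns. Let $B_n^u$ and $W_n^u=n-B_n^u$ be the numbers of black and white balls in urn $u$ at time $n$, and let $B_n^*=\sum_u B_n^u$ and $W_n^*=\sum_u W_n^u$. The ball added to urn $u$ at time $n$ has colour $\mathfrak c_n^u$, determined as follows: - if $X_n^u=1$ (draw from all urns combined), then $\mathfrak c_n^u$ is black if $V_n^u<\pi(B_{n-1}^*,W_{n-1}^*)$, and white otherwise; - if $X_n^u=-1$ (draw from urn $u$ alone), then $\mathfrak c_n^u$ is black if $V_n^u<\pi(B_{n-1}^u,W_{n-1}^u)$, and white otherwise.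 Then $$\mathbb P\bigl[\exists\, n_0\ge 1,\ \exists\, d\in\{\text{black},\text{white}\}\ \text{such that}\ \mathfrak c_n^u=d\ \text{ for all } n\ge n_0 \text{ and all } u\in\{1,\dots,U\}\bigr]=1.$$ -/

import Mathlib

open MeasureTheory ProbabilityTheory

namespace InteractingUrns

/-- The two colours of balls. -/
inductive Colour
  | black
  | white

/-- `π(i, j) = w_i / (w_i + w_j)`: the probability of drawing a ball of a given colour when there
are `i` balls of this colour and `j` balls of the other colour. -/
noncomputable def drawProb (w : ℕ → ℝ) (i j : ℕ) : ℝ := w i / (w i + w j)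

variable {U : ℕ}

/-- An urn path; `r n u` is the number of black balls in urn `u` at time `n`. -/
def IsUrnPath (r : ℕ → Fin U → ℕ) : Prop :=
  (∀ u, r 0 u = 0) ∧ ∀ n u, r (n + 1) u = r n u ∨ r (n + 1) u = r n u + 1

/-- The number of white balls in urn `u` at time `n`, each urn containing `n` balls in total
(the subtraction does not truncate along an urn path, see `IsUrnPath.le`). -/
def whiteCount (r : ℕ → Fin U → ℕ) (n : ℕ) (u : Fin U) : ℕ := n - r n u

/-- The total number of black balls at time `n`. -/
def totalBlack (r : ℕ → Fin U → ℕ) (n : ℕ) : ℕ := ∑ u, r n u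

/-- The total number of white balls at time `n`. -/
def totalWhite (r : ℕ → Fin U → ℕ) (n : ℕ) : ℕ := ∑ u, whiteCount r n u

/-- The colour of the ball which is added to urn `u` at time `n ≥ 1`. -/
def colour (r : ℕ → Fin U → ℕ) (n : ℕ) (u : Fin U) : Colour :=
  if r n u = r (n - 1) u + 1 then Colour.black else Colour.white

/-- The threshold below which the uniform variable of urn `u` yields a black ball at time `n + 1`:
all urns combined are used if `e = 1`, urn `u` alone otherwise (that is, if `e = -1`). -/
noncomputable def blackProb (w : ℕ → ℝ) (r : ℕ → Fin U → ℕ) (n : ℕ) (e : ℤ) (u : Fin U) : ℝ :=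
  if e = 1 then drawProb w (totalBlack r n) (totalWhite r n)
  else drawProb w (r n u) (whiteCount r n u)

/-- The path (numbers of black balls) of the interacting urn mechanism with weights `w`, environment `x` and
uniforms `v`. Steps are numbered from `0`: `x n` and `v n` govern the balls added at time `n + 1`,
given the configuration at time `n`; see `urnPath_succ` for the recursion. -/
noncomputable def urnPath (w : ℕ → ℝ) (x : ℕ → Fin U → ℤ) (v : ℕ → Fin U → ℝ) :
    ℕ → Fin U → ℕ
  | 0 => fun _ => 0
  | n + 1 => fun u =>
      urnPath w x v n u +
        if v n u < blackProb w (fun _ => urnPath w x v n) n (x n u) u then 1 else 0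

/-- The driving randomness: the `X n u` are i.i.d. with law `p δ₁ + (1 - p) δ₋₁`, the `V n u` are
i.i.d. uniform on `[0, 1]`, and the two families are independent of each other. -/
structure IsDriving {Ω : Type*} [MeasurableSpace Ω] (μ : Measure Ω) (p : ℝ)
    (X : ℕ → Fin U → Ω → ℤ) (V : ℕ → Fin U → Ω → ℝ) : Prop where
  measurable_X : ∀ n u, Measurable (X n u)
  measurable_V : ∀ n u, Measurable (V n u)
  law_X : ∀ n u, μ.map (X n u) =
    ENNReal.ofReal p • Measure.dirac 1 + ENNReal.ofReal (1 - p) • Measure.dirac (-1)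
  law_V : ∀ n u, μ.map (V n u) = volume.restrict (Set.Icc 0 1)
  indep_X : iIndepFun (fun k : ℕ × Fin U => X k.1 k.2) μ
  indep_V : iIndepFun (fun k : ℕ × Fin U => V k.1 k.2) μ
  indep_X_V : IndepFun (fun ω (k : ℕ × Fin U) => X k.1 k.2 ω)
    (fun ω (k : ℕ × Fin U) => V k.1 k.2 ω) μ

/-- The interacting urn mechanism driven by the random variables `X` and `V`. -/
noncomputable def ium {Ω : Type*} (w : ℕ → ℝ) (X : ℕ → Fin U → Ω → ℤ) (V : ℕ → Fin U → Ω → ℝ)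
    (ω : Ω) : ℕ → Fin U → ℕ :=
  urnPath w (fun n u => X n u ω) (fun n u => V n u ω)

theorem IsUrnPath.le {r : ℕ → Fin U → ℕ} (h : IsUrnPath r) (n : ℕ) (u : Fin U) : r n u ≤ n := by
  induction n with
  | zero => simp [h.1 u]
  | succ n ih => rcases h.2 n u with h' | h' <;> omega

/-- The recursion of the interacting urn mechanism. -/
theorem urnPath_succ (w : ℕ → ℝ) (x : ℕ → Fin U → ℤ) (v : ℕ → Fin U → ℝ) (n : ℕ) (u : Fin U) :
    urnPath w x v (n + 1) u = urnPath w x v n u +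
      if v n u < blackProb w (urnPath w x v) n (x n u) u then 1 else 0 := by
  rfl

theorem isUrnPath_urnPath (w : ℕ → ℝ) (x : ℕ → Fin U → ℤ) (v : ℕ → Fin U → ℝ) :
    IsUrnPath (urnPath w x v) := by
  refine ⟨fun u => rfl, fun n u => ?_⟩
  rw [urnPath_succ]
  split_ifs <;> simp

end InteractingUrns

/-! With weights ρ^i a draw depends only on the excess of black over white balls, through the
increasing function `sig`. Call a step of an urn good at level K if it uses the combined urns and
its uniform lies between `sig ρ (-K)` and `sig ρ K`. Whenever the total excess has modulus at least
K, a good step follows the majority. Bad steps are independent, with probability 1 - p(1 - 2 `sig ρ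
(-K)`), which is below 1/2 for large K because p > 1/2. So with probability at least 1/2 the bad
steps of every urn stay below a line of slope r < 1/2 (`measure_exists_lt_sum_le`). Started far
enough out, the total then never falls back below K, and every excess grows linearly
(`drift_of_sum_le`). Draws against such a majority have summable probabilities, so they stop by
Borel–Cantelli (`ae_eventually_mem_Ico`).

The total is brought far out by a block of prescribed driving variables that works from every
configuration (`abs_sum_excess_of_block`). Block and line bound are therefore events of the driving
variables alone, with probability bounded below, and the zero-one law (`ae_frequently_of_future`)
produces a time at which both occur. No conditioning on the urns is needed. -/

open Filter

namespace InteractingUrns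

/-! ### Thresholds and the dynamics of the excess. -/

/-- The probability of drawing black when the black balls outnumber the white ones by `x`. -/
noncomputable def sig (ρ x : ℝ) : ℝ := 1 / (1 + ρ ^ (-x))

theorem sig_pos {ρ : ℝ} (hρ : 1 < ρ) (x : ℝ) : 0 < sig ρ x := by
  have := Real.rpow_pos_of_pos (zero_lt_one.trans hρ) (-x)
  unfold sig; positivity

theorem sig_strictMono {ρ : ℝ} (hρ : 1 < ρ) : StrictMono (sig ρ) := by
  intro x y hxy
  have := Real.rpow_pos_of_pos (zero_lt_one.trans hρ) (-y)
  exact one_div_lt_one_div_of_lt (by positivity)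
    (by gcongr 1 + ?_; exact Real.rpow_lt_rpow_of_exponent_lt hρ (neg_lt_neg hxy))

theorem sig_neg {ρ : ℝ} (hρ : 1 < ρ) (x : ℝ) : sig ρ (-x) = 1 - sig ρ x := by
  have hρ0 := zero_lt_one.trans hρ
  have h := Real.rpow_pos_of_pos hρ0 x
  unfold sig
  rw [neg_neg, Real.rpow_neg hρ0.le]
  field_simp
  ring

theorem sig_lt_one {ρ : ℝ} (hρ : 1 < ρ) (x : ℝ) : sig ρ x < 1 := by
  have := sig_pos hρ (-x)
  rw [sig_neg hρ] at this
  linarith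

theorem sig_neg_le {ρ : ℝ} (hρ : 1 < ρ) (x : ℝ) : sig ρ (-x) ≤ ρ ^ (-x) := by
  have hρ0 := zero_lt_one.trans hρ
  have h := Real.rpow_pos_of_pos hρ0 x
  unfold sig
  rw [neg_neg, Real.rpow_neg hρ0.le, ← one_div]
  exact one_div_le_one_div_of_le h (by linarith)

/-- Exponential weights turn the ratio of weights into a function of the difference of the counts;
this is what allows the argument to follow the excess alone. -/
theorem drawProb_pow {ρ : ℝ} (hρ : 1 < ρ) (i j : ℕ) :
    drawProb (fun i => ρ ^ i) i j = sig ρ ((i : ℝ) - j) := by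
  have hρ0 := zero_lt_one.trans hρ
  have hi : 0 < ρ ^ i := by positivity
  have hj : 0 < ρ ^ j := by positivity
  unfold drawProb sig
  rw [neg_sub, Real.rpow_sub hρ0, Real.rpow_natCast, Real.rpow_natCast]
  field_simp

variable {U : ℕ}

/-- The number of black balls minus the number of white balls in urn `u` at time `n`. -/
def excess (r : ℕ → Fin U → ℕ) (n : ℕ) (u : Fin U) : ℤ := 2 * r n u - n

theorem sub_whiteCount {r : ℕ → Fin U → ℕ} (h : IsUrnPath r) (n : ℕ) (u : Fin U) :
    (r n u : ℤ) - whiteCount r n u = excess r n u := by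
  have := h.le n u
  unfold whiteCount excess
  omega

theorem totalBlack_sub_totalWhite {r : ℕ → Fin U → ℕ} (h : IsUrnPath r) (n : ℕ) :
    (totalBlack r n : ℤ) - totalWhite r n = ∑ u, excess r n u := by
  simp only [totalBlack, totalWhite, Nat.cast_sum, ← Finset.sum_sub_distrib, sub_whiteCount h]

theorem blackProb_pow {ρ : ℝ} (hρ : 1 < ρ) {r : ℕ → Fin U → ℕ} (h : IsUrnPath r) (n : ℕ) (e : ℤ)
    (u : Fin U) :
    blackProb (fun i => ρ ^ i) r n e u =
      sig ρ (if e = 1 then (∑ v, excess r n v : ℤ) else excess r n u : ℤ) := by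
  unfold blackProb
  split_ifs
  · rw [drawProb_pow hρ, ← totalBlack_sub_totalWhite h]; push_cast; rfl
  · rw [drawProb_pow hρ, ← sub_whiteCount h]; push_cast; rfl

theorem excess_succ_of_lt {ρ : ℝ} (hρ : 1 < ρ) {x : ℕ → Fin U → ℤ} {v : ℕ → Fin U → ℝ} {n : ℕ}
    {u : Fin U}
    (hv : v n u < sig ρ (if x n u = 1 then
      (∑ j, excess (urnPath (fun i => ρ ^ i) x v) n j : ℤ) else
      excess (urnPath (fun i => ρ ^ i) x v) n u : ℤ)) :
    excess (urnPath (fun i => ρ ^ i) x v) (n + 1) u =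
      excess (urnPath (fun i => ρ ^ i) x v) n u + 1 := by
  rw [← blackProb_pow hρ (isUrnPath_urnPath _ x v)] at hv
  have := urnPath_succ (fun i => ρ ^ i) x v n u
  rw [if_pos hv] at this
  unfold excess
  rw [this]; push_cast; ring

theorem excess_succ_of_le {ρ : ℝ} (hρ : 1 < ρ) {x : ℕ → Fin U → ℤ} {v : ℕ → Fin U → ℝ} {n : ℕ}
    {u : Fin U}
    (hv : sig ρ (if x n u = 1 then
      (∑ j, excess (urnPath (fun i => ρ ^ i) x v) n j : ℤ) else
      excess (urnPath (fun i => ρ ^ i) x v) n u : ℤ) ≤ v n u) :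
    excess (urnPath (fun i => ρ ^ i) x v) (n + 1) u =
      excess (urnPath (fun i => ρ ^ i) x v) n u - 1 := by
  rw [← blackProb_pow hρ (isUrnPath_urnPath _ x v)] at hv
  have := urnPath_succ (fun i => ρ ^ i) x v n u
  rw [if_neg hv.not_gt] at this
  unfold excess
  rw [this]; push_cast; ring

theorem IsUrnPath.excess_succ {r : ℕ → Fin U → ℕ} (h : IsUrnPath r) (n : ℕ) (u : Fin U) :
    excess r (n + 1) u = excess r n u + 1 ∨ excess r (n + 1) u = excess r n u - 1 := by
  unfold excess
  rcases h.2 n u with h | h <;> rw [h] <;> push_cast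
  · right; ring
  · left; ring

theorem colour_eq_black {r : ℕ → Fin U → ℕ} {n : ℕ} {u : Fin U}
    (h : excess r (n + 1) u = excess r n u + 1) : colour r (n + 1) u = Colour.black := by
  unfold excess at h
  unfold colour
  rw [if_pos]
  rw [Nat.add_sub_cancel]
  push_cast at h
  omega

theorem colour_eq_white {r : ℕ → Fin U → ℕ} {n : ℕ} {u : Fin U}
    (h : excess r (n + 1) u = excess r n u - 1) : colour r (n + 1) u = Colour.white := by
  unfold excess at h
  unfold colour
  rw [if_neg]
  rw [Nat.add_sub_cancel]
  push_cast at h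
  omega

/-! ### Pathwise estimates. -/

/-- Along a block of steps which all use the combined urns and whose uniforms lie in the gap
between two consecutive thresholds, the total excess moves monotonically away from the gap. -/
theorem abs_sum_excess_of_block {ρ : ℝ} (hρ : 1 < ρ) (hU : 0 < U) {x : ℕ → Fin U → ℤ}
    {v : ℕ → Fin U → ℝ} {n m K : ℕ}
    (h : ∀ j < m, ∀ u, x (n + j) u = 1 ∧
      v (n + j) u ∈ Set.Ioo (sig ρ (-(K + 1 : ℝ))) (sig ρ (-(K : ℝ)))) :
    (m : ℤ) - K ≤ ∑ u, excess (urnPath (fun i => ρ ^ i) x v) (n + m) u ∨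
      ∑ u, excess (urnPath (fun i => ρ ^ i) x v) (n + m) u ≤ -((m : ℤ) - K) := by
  set D := excess (urnPath (fun i => ρ ^ i) x v) with hD
  have hU' : (1 : ℤ) ≤ U := by exact_mod_cast hU
  have hmono := (sig_strictMono hρ).monotone
  -- The total is an integer, so it lies at or above -K or at or below -(K + 1). The uniforms of the
  -- block fall strictly between these two thresholds, so all urns move the same way and the
  -- alternative persists.
  rcases le_or_gt (-(K : ℤ)) (∑ u, D n u) with h0 | h0
  · left
    have key : ∀ j ≤ m, (j : ℤ) - K ≤ ∑ u, D (n + j) u := by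
      intro j
      induction j with
      | zero => intro _; simpa using h0
      | succ j ih =>
        intro hj
        have ih := ih (by omega)
        have hstep : ∀ u, D (n + j + 1) u = D (n + j) u + 1 := fun u => by
          apply excess_succ_of_lt hρ
          rw [if_pos (h j (by omega) u).1]
          refine (h j (by omega) u).2.2.trans_le (hmono ?_)
          have : -(K : ℤ) ≤ ∑ u, D (n + j) u := by omega
          exact_mod_cast this
        rw [← add_assoc, Finset.sum_congr rfl fun u _ => hstep u, Finset.sum_add_distrib]
        simp
        omega
    exact key m le_rfl
  · right
    have key : ∀ j ≤ m, ∑ u, D (n + j) u ≤ -(j : ℤ) - K - 1 := by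
      intro j
      induction j with
      | zero => intro _; simp; omega
      | succ j ih =>
        intro hj
        have ih := ih (by omega)
        have hstep : ∀ u, D (n + j + 1) u = D (n + j) u - 1 := fun u => by
          apply excess_succ_of_le hρ
          rw [if_pos (h j (by omega) u).1]
          refine le_trans (hmono ?_) (h j (by omega) u).2.1.le
          have : ∑ u, D (n + j) u ≤ -(K + 1 : ℤ) := by omega
          exact_mod_cast this
        rw [← add_assoc, Finset.sum_congr rfl fun u _ => hstep u, Finset.sum_sub_distrib]
        simp
        omega
    have := key m le_rfl
    omega

/-- A bound on the number of backward steps keeps the total above the threshold `K`, above which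
only the steps marked by `b` go backward. -/
theorem drift_of_sum_le {D b : ℕ → Fin U → ℝ} {K L r : ℝ} {N : ℕ} (hr : r ≤ 1 / 2)
    (hstep : ∀ n u, K ≤ ∑ j, D n j → D n u + 1 - 2 * b n u ≤ D (n + 1) u)
    (hb : ∀ u (k : ℕ), ∑ j ∈ Finset.range k, b (N + j) u ≤ r * k + L)
    (hN : K + 2 * U * L ≤ ∑ u, D N u) (k : ℕ) (u : Fin U) :
    D N u + (1 - 2 * r) * k - 2 * L ≤ D (N + k) u := by
  have key : ∀ k : ℕ, ∀ u, D N u + k - 2 * ∑ j ∈ Finset.range k, b (N + j) u ≤ D (N + k) u := by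
    intro k
    induction k with
    | zero => intro u; simp
    | succ k ih =>
      intro u
      -- Each urn loses at most 2L from its initial value, since the drift 1 - 2r is nonnegative;
      -- the margin 2UL in `hN` absorbs this loss over all urns.
      have hK : K ≤ ∑ j, D (N + k) j := by
        have h1 : ∑ u, (D N u - 2 * L) ≤ ∑ j, D (N + k) j := by
          refine Finset.sum_le_sum fun u _ => ?_
          have := ih u
          have := hb u k
          have : 0 ≤ (1 - 2 * r) * k := mul_nonneg (by linarith) k.cast_nonneg
          linarith
        rw [Finset.sum_sub_distrib] at h1
        simp at h1
        linarith
      have := hstep (N + k) u hK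
      have := ih u
      rw [Finset.sum_range_succ, ← add_assoc]
      push_cast
      linarith
  have := key k u
  have := hb u k
  linarith

/-- The steps which may go against the majority even if the majority exceeds `K`. -/
noncomputable def badStep (ρ K : ℝ) (z : ℤ × ℝ) : ℝ :=
  open Classical in
  if z.1 = 1 ∧ z.2 ∈ Set.Ioo (sig ρ (-K)) (sig ρ K) then 0 else 1

/-- This is the whole deterministic argument. The block length is chosen so that m - K = K + 2UL,
the margin required by `drift_of_sum_le`. The resulting slope 1 - 2r exceeds α, so eventually both
the total and the individual excesses clear the thresholds at ±αk. -/
theorem exists_colour_of_block_of_sum_le {ρ : ℝ} (hρ : 1 < ρ) (hU : 0 < U) {x : ℕ → Fin U → ℤ}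
    {v : ℕ → Fin U → ℝ} {n m K L : ℕ} {r α : ℝ} (hr : r < 1 / 2) (hα : 0 ≤ α)
    (hαr : α < 1 - 2 * r) (hm : m = 2 * K + 2 * U * L)
    (hblock : ∀ j < m, ∀ u, x (n + j) u = 1 ∧
      v (n + j) u ∈ Set.Ioo (sig ρ (-(K + 1 : ℝ))) (sig ρ (-(K : ℝ))))
    (hb : ∀ u (k : ℕ),
      ∑ j ∈ Finset.range k, badStep ρ K (x (n + m + j) u, v (n + m + j) u) ≤ r * k + L)
    (hv : ∀ᶠ k : ℕ in atTop, ∀ u, v k u ∈ Set.Ico (sig ρ (-(α * k))) (sig ρ (α * k))) :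
    ∃ n₀ : ℕ, 1 ≤ n₀ ∧ ∃ d : Colour, ∀ k, n₀ ≤ k → ∀ u : Fin U,
      colour (urnPath (fun i => ρ ^ i) x v) k u = d := by
  set R := urnPath (fun i => ρ ^ i) x v with hR
  have hmono := (sig_strictMono hρ).monotone
  have hpath : IsUrnPath R := isUrnPath_urnPath _ x v
  have hlin : ∀ c : ℝ, ∀ᶠ k : ℕ in atTop, α * (n + m + k : ℕ) ≤ c + (1 - 2 * r) * k - 2 * L := by
    intro c
    have h1 : Tendsto (fun k : ℕ => (1 - 2 * r - α) * (k : ℝ)) atTop atTop :=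
      tendsto_natCast_atTop_atTop.const_mul_atTop (by linarith)
    filter_upwards [h1.eventually_ge_atTop (α * (n + m) - c + 2 * L)] with k hk
    push_cast
    linarith
  have hshift : ∀ {P : ℕ → Prop}, (∀ᶠ k in atTop, P (n + m + k)) → ∀ᶠ k in atTop, P k := by
    intro P hP
    rw [eventually_atTop] at hP ⊢
    obtain ⟨a, ha⟩ := hP
    refine ⟨n + m + a, fun k hk => ?_⟩
    have := ha (k - (n + m)) (by omega)
    rwa [Nat.add_sub_cancel' (by omega)] at this
  -- Combined draws see the total, which dominates any single excess once all excesses have the same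
  -- sign.
  have hsum : ∀ (k : ℕ) (f : Fin U → ℝ), (∀ u, α * k ≤ f u) → α * k ≤ ∑ u, f u := by
    intro k f hf
    have hk : 0 ≤ α * (k : ℝ) := by positivity
    exact (hf ⟨0, hU⟩).trans (Finset.single_le_sum (f := f)
      (fun u _ => hk.trans (hf u)) (Finset.mem_univ _))
  rcases abs_sum_excess_of_block hρ hU hblock with h0 | h0
  · have hd := drift_of_sum_le (D := fun n u => (excess R n u : ℝ))
      (b := fun n u => badStep ρ K (x n u, v n u)) (K := K) (L := L) (r := r) (N := n + m) hr.le
      (by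
        intro k u hk
        unfold badStep
        split_ifs with hg
        · have : excess R (k + 1) u = excess R k u + 1 := by
            apply excess_succ_of_lt hρ
            rw [if_pos hg.1]
            refine hg.2.2.trans_le (hmono ?_)
            push_cast
            exact hk
          simp only [this]; push_cast; linarith
        · rcases hpath.excess_succ k u with h | h <;> simp only [h] <;> push_cast <;> linarith)
      hb
      (by
        have : (K : ℤ) + 2 * U * L ≤ ∑ u, excess R (n + m) u := by
          refine le_trans ?_ h0; rw [hm]; push_cast; linarith
        exact_mod_cast this)
    have hev : ∀ᶠ k : ℕ in atTop, ∀ u, α * k ≤ excess R k u := by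
      apply hshift
      rw [eventually_all]
      intro u
      filter_upwards [hlin (excess R (n + m) u)] with k hk
      exact hk.trans (hd k u)
    obtain ⟨a, ha⟩ := eventually_atTop.1 (hev.and hv)
    refine ⟨a + 1, by omega, Colour.black, fun k hk u => ?_⟩
    obtain ⟨k, rfl⟩ : ∃ j, k = j + 1 := ⟨k - 1, by omega⟩
    obtain ⟨h1, h2⟩ := ha k (by omega)
    apply colour_eq_black
    apply excess_succ_of_lt hρ
    refine (h2 u).2.trans_le (hmono ?_)
    split_ifs
    · push_cast
      exact hsum k _ h1
    · exact h1 u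
  -- White majority: the same argument for the negated excess.
  · have hd := drift_of_sum_le (D := fun n u => -(excess R n u : ℝ))
      (b := fun n u => badStep ρ K (x n u, v n u)) (K := K) (L := L) (r := r) (N := n + m) hr.le
      (by
        intro k u hk
        unfold badStep
        split_ifs with hg
        · have : excess R (k + 1) u = excess R k u - 1 := by
            apply excess_succ_of_le hρ
            rw [if_pos hg.1]
            refine le_trans (hmono ?_) hg.2.1.le
            rw [Finset.sum_neg_distrib] at hk
            push_cast
            linarith
          simp only [this]; push_cast; linarith
        · rcases hpath.excess_succ k u with h | h <;> simp only [h] <;> push_cast <;> linarith)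
      hb
      (by
        have : (K : ℤ) + 2 * U * L ≤ ∑ u, -excess R (n + m) u := by
          rw [Finset.sum_neg_distrib, le_neg]
          refine le_trans h0 ?_; rw [hm]; push_cast; linarith
        exact_mod_cast this)
    have hev : ∀ᶠ k : ℕ in atTop, ∀ u, α * k ≤ -(excess R k u : ℝ) := by
      apply hshift
      rw [eventually_all]
      intro u
      filter_upwards [hlin (-(excess R (n + m) u : ℝ))] with k hk
      exact hk.trans (hd k u)
    obtain ⟨a, ha⟩ := eventually_atTop.1 (hev.and hv)
    refine ⟨a + 1, by omega, Colour.white, fun k hk u => ?_⟩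
    obtain ⟨k, rfl⟩ : ∃ j, k = j + 1 := ⟨k - 1, by omega⟩
    obtain ⟨h1, h2⟩ := ha k (by omega)
    apply colour_eq_white
    apply excess_succ_of_le hρ
    refine le_trans (hmono ?_) (h2 u).1
    rw [le_neg]
    split_ifs
    · push_cast
      rw [← Finset.sum_neg_distrib]
      exact hsum k _ h1
    · exact h1 u

/-! ### Independence, a zero-one law and a maximal bound. -/

variable {Ω : Type*} [mΩ : MeasurableSpace Ω] {μ : Measure Ω}

/-- Rectangles form a π-system generating the product σ-algebra. On them, independence of the two
families separates the X and V factors, each family factors over the indices, and the pairs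
recombine index by index. -/
theorem iIndepFun_prodMk {ι α β : Type*} [mα : MeasurableSpace α] [mβ : MeasurableSpace β]
    {X : ι → Ω → α} {V : ι → Ω → β} (hXm : ∀ i, Measurable (X i)) (hVm : ∀ i, Measurable (V i))
    (hX : iIndepFun X μ) (hV : iIndepFun V μ)
    (hXV : IndepFun (fun ω i => X i ω) (fun ω i => V i ω) μ) :
    iIndepFun (fun i ω => (X i ω, V i ω)) μ := by
  rw [iIndepFun_iff_iIndep]
  refine iIndepSets.iIndep (fun i => ((hXm i).prodMk (hVm i)).comap_le)
    (fun i => Set.preimage (fun ω => (X i ω, V i ω)) ''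
      Set.image2 (· ×ˢ ·) {s | MeasurableSet s} {t | MeasurableSet t})
    (fun i => isPiSystem_prod.comap _)
    (fun i => by rw [← MeasurableSpace.comap_generateFrom, generateFrom_prod]) ?_
  rw [iIndepSets_iff]
  intro s f hf
  have hf' : ∀ i, ∃ A B, i ∈ s → MeasurableSet A ∧ MeasurableSet B ∧
      f i = X i ⁻¹' A ∩ V i ⁻¹' B := by
    intro i
    by_cases hi : i ∈ s
    · obtain ⟨_, ⟨A, hA, B, hB, rfl⟩, h⟩ := hf i hi
      exact ⟨A, B, fun _ => ⟨hA, hB, h.symm⟩⟩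
    · exact ⟨∅, ∅, fun h => absurd h hi⟩
  choose A B hAB using hf'
  have hpi := hXV.measure_inter_preimage_eq_mul (Set.pi (s : Set ι) A) (Set.pi (s : Set ι) B)
    (MeasurableSet.pi s.countable_toSet fun i hi => (hAB i hi).1)
    (MeasurableSet.pi s.countable_toSet fun i hi => (hAB i hi).2.1)
  have hA : (fun ω i => X i ω) ⁻¹' Set.pi (s : Set ι) A = ⋂ i ∈ s, X i ⁻¹' A i := by
    ext; simp
  have hB : (fun ω i => V i ω) ⁻¹' Set.pi (s : Set ι) B = ⋂ i ∈ s, V i ⁻¹' B i := by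
    ext; simp
  rw [hA, hB, hX.measure_inter_preimage_eq_mul s fun i hi => (hAB i hi).1,
    hV.measure_inter_preimage_eq_mul s fun i hi => (hAB i hi).2.1] at hpi
  have hset : ⋂ i ∈ s, f i = (⋂ i ∈ s, X i ⁻¹' A i) ∩ ⋂ i ∈ s, V i ⁻¹' B i := by
    rw [Set.iInter₂_congr fun i hi => (hAB i hi).2.2]
    simp only [Set.iInter_inter_distrib]
  rw [hset, hpi, ← Finset.prod_mul_distrib]
  refine Finset.prod_congr rfl fun i hi => ?_
  rw [(hAB i hi).2.2]
  have := hXV.measure_inter_preimage_eq_mul (Function.eval i ⁻¹' A i) (Function.eval i ⁻¹' B i)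
    (measurable_pi_apply i (hAB i hi).1) (measurable_pi_apply i (hAB i hi).2.1)
  exact this.symm

/-- Events of uniformly positive probability which depend only on an ever later part of an
independent family occur infinitely often. -/
theorem ae_frequently_of_future [IsProbabilityMeasure μ] {ι : Type*}
    {s : ℕ × ι → MeasurableSpace Ω} (hle : ∀ k, s k ≤ mΩ) (hs : iIndep s μ)
    {E : ℕ → Set Ω} (hE : ∀ n, MeasurableSet[⨆ k, ⨆ (_ : n ≤ k.1), s k] (E n))
    {c : ENNReal} (hc : c ≠ 0) (hcE : ∀ n, c ≤ μ (E n)) :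
    ∀ᵐ ω ∂μ, ∃ᶠ n in atTop, ω ∈ E n := by
  have hEm : ∀ n, MeasurableSet (E n) := fun n =>
    (iSup₂_le fun k _ => hle k : (⨆ k, ⨆ (_ : n ≤ k.1), s k) ≤ mΩ) _ (hE n)
  have hlim : ∀ N, limsup E atTop = ⋂ n, ⋃ j, E (N + n + j) := by
    intro N
    ext ω
    rw [mem_limsup_iff_frequently_mem, frequently_atTop]
    simp only [Set.mem_iInter, Set.mem_iUnion]
    constructor
    · intro h n
      obtain ⟨b, hb, hbE⟩ := h (N + n)
      exact ⟨b - (N + n), by rwa [Nat.add_sub_cancel' hb]⟩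
    · intro h n
      obtain ⟨j, hj⟩ := h n
      exact ⟨_, by omega, hj⟩
  have htail : MeasurableSet[limsup s cofinite] (limsup E atTop) := by
    rw [hasBasis_cofinite.limsup_eq_iInf_iSup]
    simp only [MeasurableSpace.measurableSet_iInf]
    intro t ht
    -- A finite set of indices involves only times up to some N, and the limsup is unchanged when
    -- the events before time N + 1 are dropped.
    obtain ⟨N, hN⟩ := (ht.image Prod.fst).bddAbove
    rw [hlim (N + 1)]
    refine MeasurableSet.iInter fun n => MeasurableSet.iUnion fun j => ?_
    refine (iSup₂_le fun k hk => ?_ :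
      (⨆ k, ⨆ (_ : N + 1 + n + j ≤ k.1), s k) ≤ _) _ (hE _)
    refine le_iSup₂_of_le k (fun hkt => ?_) le_rfl
    have := hN ⟨k, hkt, rfl⟩
    omega
  have h01 := measure_zero_or_one_of_measurableSet_limsup (p := Set.Finite) (f := cofinite)
    (ns := fun a : Finset (ℕ × ι) => (a : Set (ℕ × ι))) hle hs
    (fun t ht => ht.compl_mem_cofinite)
    (directed_of_isDirected_le fun a b hab => by simpa using hab) (fun a => a.finite_toSet)
    (fun n => ⟨{n}, by simp⟩) htail
  have hpos : c ≤ μ (limsup E atTop) := by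
    rw [hlim 0]
    have hanti : Antitone fun n => ⋃ j, E (0 + n + j) := by
      refine antitone_nat_of_succ_le fun n => Set.iUnion_subset fun j => ?_
      refine subset_trans ?_ (Set.subset_iUnion _ (j + 1))
      rw [show 0 + (n + 1) + j = 0 + n + (j + 1) by ring]
    rw [hanti.measure_iInter
      (fun n => (MeasurableSet.iUnion fun j => hEm _).nullMeasurableSet)
      ⟨0, measure_ne_top _ _⟩]
    exact le_iInf fun n => (hcE (0 + n + 0)).trans
      (measure_mono (Set.subset_iUnion (fun j => E (0 + n + j)) 0))
  have h1 : μ (limsup E atTop) = 1 := h01.resolve_left fun h0 => hc (by simpa [h0] using hpos)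
  have hm : MeasurableSet (limsup E atTop) := MeasurableSet.measurableSet_limsup hEm
  have := (mem_ae_iff_prob_eq_one hm).2 h1
  filter_upwards [this] with ω hω
  exact mem_limsup_iff_frequently_mem.1 hω

/-- The partial sums of bounded independent variables of mean `q < r` rarely exceed a line of
slope `r`. -/
theorem measure_exists_lt_sum_le [IsProbabilityMeasure μ] {Y : ℕ → Ω → ℝ} (hY : iIndepFun Y μ)
    (hYm : ∀ j, Measurable (Y j)) (hY01 : ∀ j ω, Y j ω ∈ Set.Icc (0 : ℝ) 1) {q r L : ℝ}
    (hq : ∀ j, ∫ ω, Y j ω ∂μ = q) (hqr : q < r) (hL : 0 ≤ L) :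
    μ {ω | ∃ k : ℕ, r * k + L < ∑ j ∈ Finset.range k, Y j ω} ≤
      ENNReal.ofReal (Real.exp (-(4 * (r - q) * L)) * (1 - Real.exp (-(2 * (r - q) ^ 2)))⁻¹) := by
  set δ := r - q with hδ
  have hδ0 : 0 < δ := sub_pos.2 hqr
  -- Hoeffding's lemma: variance proxy 1/4. The tail at δk + L is then at most exp(-2(δk + L)²/k),
  -- and discarding the L² term leaves a geometric sequence in k.
  have hsub : ∀ j, HasSubgaussianMGF (fun ω => Y j ω - q) ((‖(1 : ℝ) - 0‖₊ / 2) ^ 2) μ := by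
    intro j
    have := hasSubgaussianMGF_of_mem_Icc (hYm j).aemeasurable (ae_of_all μ (hY01 j))
    rwa [hq j] at this
  have hind : iIndepFun (fun j ω => Y j ω - q) μ :=
    hY.comp (fun _ y => y - q) fun _ => measurable_id.sub_const q
  have hk : ∀ k : ℕ, μ {ω | r * k + L < ∑ j ∈ Finset.range k, Y j ω} ≤
      ENNReal.ofReal (Real.exp (-(4 * δ * L)) * Real.exp (-(2 * δ ^ 2)) ^ k) := by
    intro k
    rcases Nat.eq_zero_or_pos k with rfl | hk0
    · simp [hL.not_gt]
    have hk0' : (0 : ℝ) < k := by exact_mod_cast hk0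
    have h := HasSubgaussianMGF.measure_sum_range_ge_le_of_iIndepFun hind (n := k)
      (fun j _ => hsub j) (ε := δ * k + L) (by positivity)
    have hle : {ω | r * k + L < ∑ j ∈ Finset.range k, Y j ω} ⊆
        {ω | δ * k + L ≤ ∑ j ∈ Finset.range k, (Y j ω - q)} := by
      intro ω hω
      simp only [Set.mem_ofPred_eq, Finset.sum_sub_distrib, Finset.sum_const, Finset.card_range,
        nsmul_eq_mul] at hω ⊢
      rw [hδ]
      linarith
    refine (measure_mono hle).trans ?_
    rw [← ENNReal.ofReal_toReal (measure_ne_top μ _)]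
    refine ENNReal.ofReal_le_ofReal (h.trans ?_)
    rw [← Real.exp_nat_mul, ← Real.exp_add]
    apply Real.exp_le_exp.2
    have : ((((‖(1 : ℝ) - 0‖₊ / 2) ^ 2 : NNReal)) : ℝ) = 1 / 4 := by
      simp; norm_num
    rw [this, div_le_iff₀ (by positivity)]
    nlinarith [sq_nonneg L]
  have hsum : Summable fun k : ℕ =>
      Real.exp (-(4 * δ * L)) * Real.exp (-(2 * δ ^ 2)) ^ k :=
    (summable_geometric_of_lt_one (Real.exp_pos _).le
      (by simpa using pow_pos hδ0 2)).mul_left _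
  have hset : {ω | ∃ k : ℕ, r * k + L < ∑ j ∈ Finset.range k, Y j ω} =
      ⋃ k : ℕ, {ω | r * k + L < ∑ j ∈ Finset.range k, Y j ω} := by
    ext; simp
  rw [hset]
  calc _ ≤ ∑' k : ℕ, μ {ω | r * k + L < ∑ j ∈ Finset.range k, Y j ω} := measure_iUnion_le _
    _ ≤ ∑' k : ℕ, ENNReal.ofReal (Real.exp (-(4 * δ * L)) * Real.exp (-(2 * δ ^ 2)) ^ k) :=
      ENNReal.tsum_le_tsum hk
    _ = _ := by
      rw [← ENNReal.ofReal_tsum_of_nonneg (fun k => by positivity) hsum, tsum_mul_left,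
        tsum_geometric_of_lt_one (Real.exp_pos _).le (by simpa using pow_pos hδ0 2)]

theorem measurable_badStep (ρ K : ℝ) : Measurable (badStep ρ K) := by
  unfold badStep
  refine Measurable.ite ?_ measurable_const measurable_const
  exact (measurable_fst (measurableSet_singleton (1 : ℤ))).inter (measurable_snd measurableSet_Ioo)

theorem badStep_mem_Icc (ρ K : ℝ) (z : ℤ × ℝ) : badStep ρ K z ∈ Set.Icc (0 : ℝ) 1 := by
  unfold badStep
  split_ifs <;> simp

/-! ### Estimates for the driving variables. -/

namespace IsDriving

variable {p : ℝ} {X : ℕ → Fin U → Ω → ℤ} {V : ℕ → Fin U → Ω → ℝ}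

theorem measurable_pair (h : IsDriving μ p X V) (k : ℕ × Fin U) :
    Measurable fun ω => (X k.1 k.2 ω, V k.1 k.2 ω) :=
  (h.measurable_X k.1 k.2).prodMk (h.measurable_V k.1 k.2)

theorem iIndepFun_pair (h : IsDriving μ p X V) :
    iIndepFun (fun (k : ℕ × Fin U) ω => (X k.1 k.2 ω, V k.1 k.2 ω)) μ :=
  iIndepFun_prodMk (fun k => h.measurable_X k.1 k.2) (fun k => h.measurable_V k.1 k.2)
    h.indep_X h.indep_V h.indep_X_V

theorem measure_pair (h : IsDriving μ p X V) (k : ℕ × Fin U) {a b : ℝ} (ha : 0 ≤ a) (hb : b ≤ 1) :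
    μ ((fun ω => (X k.1 k.2 ω, V k.1 k.2 ω)) ⁻¹' ({1} ×ˢ Set.Ioo a b)) =
      ENNReal.ofReal p * ENNReal.ofReal (b - a) := by
  have hXV := h.indep_X_V.measure_inter_preimage_eq_mul (Function.eval k ⁻¹' {1})
    (Function.eval k ⁻¹' Set.Ioo a b) (measurable_pi_apply k (measurableSet_singleton _))
    (measurable_pi_apply k measurableSet_Ioo)
  have hX : μ (X k.1 k.2 ⁻¹' {1}) = ENNReal.ofReal p := by
    rw [← Measure.map_apply (h.measurable_X _ _) (measurableSet_singleton _), h.law_X]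
    simp
  have hV : μ (V k.1 k.2 ⁻¹' Set.Ioo a b) = ENNReal.ofReal (b - a) := by
    rw [← Measure.map_apply (h.measurable_V _ _) measurableSet_Ioo, h.law_V,
      Measure.restrict_apply measurableSet_Ioo, Set.inter_eq_left.2, Real.volume_Ioo]
    exact fun x hx => ⟨ha.trans hx.1.le, hx.2.le.trans hb⟩
  rw [← hX, ← hV]
  exact hXV

theorem integral_badStep [IsProbabilityMeasure μ] (h : IsDriving μ p X V) (hp : 0 ≤ p) {ρ : ℝ}
    (hρ : 1 < ρ) {K : ℝ} (hK : 0 ≤ K) (k : ℕ × Fin U) :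
    ∫ ω, badStep ρ K (X k.1 k.2 ω, V k.1 k.2 ω) ∂μ = 1 - p * (1 - 2 * sig ρ (-K)) := by
  set G := (fun ω => (X k.1 k.2 ω, V k.1 k.2 ω)) ⁻¹' ({1} ×ˢ Set.Ioo (sig ρ (-K)) (sig ρ K))
  have hG : MeasurableSet G :=
    h.measurable_pair k ((measurableSet_singleton _).prod measurableSet_Ioo)
  have hind : (fun ω => badStep ρ K (X k.1 k.2 ω, V k.1 k.2 ω)) = Gᶜ.indicator 1 := by
    ext ω
    by_cases hω : ω ∈ G
    · have : X k.1 k.2 ω = 1 ∧ V k.1 k.2 ω ∈ Set.Ioo (sig ρ (-K)) (sig ρ K) := hω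
      simp only [badStep, if_pos this]
      rw [Set.indicator_of_notMem (by simpa using hω)]
    · have : ¬ (X k.1 k.2 ω = 1 ∧ V k.1 k.2 ω ∈ Set.Ioo (sig ρ (-K)) (sig ρ K)) := hω
      simp only [badStep, if_neg this]
      rw [Set.indicator_of_mem (by simpa using hω)]
      rfl
  have hmono : sig ρ (-K) ≤ sig ρ K := (sig_strictMono hρ).monotone (by linarith)
  rw [hind, integral_indicator_one hG.compl, probReal_compl_eq_one_sub hG, Measure.real,
    h.measure_pair k (sig_pos hρ _).le (sig_lt_one hρ _).le, ENNReal.toReal_mul,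
    ENNReal.toReal_ofReal hp, ENNReal.toReal_ofReal (by linarith), sig_neg hρ]
  ring

/-- The uniforms eventually stay between thresholds which approach `0` and `1` exponentially
fast. -/
theorem ae_eventually_mem_Ico (h : IsDriving μ p X V) {ρ α : ℝ} (hρ : 1 < ρ) (hα : 0 < α) :
    ∀ᵐ ω ∂μ, ∀ᶠ k : ℕ in atTop, ∀ u,
      V k u ω ∈ Set.Ico (sig ρ (-(α * k))) (sig ρ (α * k)) := by
  simp only [eventually_all]
  intro u
  have hρ0 := zero_lt_one.trans hρ
  have hlt : ρ ^ (-α) < 1 := Real.rpow_lt_one_of_one_lt_of_neg hρ (neg_lt_zero.2 hα)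
  -- Each of the two excluded ends of [0, 1] has length `sig ρ (-(α * k))`, which is at most
  -- ρ^(-αk).
  have hbound : ∀ k : ℕ, μ {ω | V k u ω ∉ Set.Ico (sig ρ (-(α * k))) (sig ρ (α * k))} ≤
      ENNReal.ofReal (2 * (ρ ^ (-α)) ^ k) := by
    intro k
    have hle := sig_neg_le hρ (α * k)
    have hpow : ρ ^ (-(α * k)) = (ρ ^ (-α)) ^ k := by
      rw [← Real.rpow_natCast, ← Real.rpow_mul hρ0.le, neg_mul]
    rw [hpow] at hle
    have hms : MeasurableSet (Set.Ico (sig ρ (-(α * k))) (sig ρ (α * k)))ᶜ :=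
      measurableSet_Ico.compl
    calc μ (V k u ⁻¹' (Set.Ico (sig ρ (-(α * k))) (sig ρ (α * k)))ᶜ)
        = volume ((Set.Ico (sig ρ (-(α * k))) (sig ρ (α * k)))ᶜ ∩ Set.Icc 0 1) := by
          rw [← Measure.map_apply (h.measurable_V _ _) hms, h.law_V, Measure.restrict_apply hms]
      _ ≤ volume (Set.Icc 0 (sig ρ (-(α * k))) ∪ Set.Icc (sig ρ (α * k)) 1) := by
          refine measure_mono ?_
          rintro x ⟨hx, hx0, hx1⟩
          simp only [Set.mem_compl_iff, Set.mem_Ico, not_and_or, not_le, not_lt] at hx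
          rcases hx with hx | hx
          · exact Or.inl ⟨hx0, hx.le⟩
          · exact Or.inr ⟨hx, hx1⟩
      _ ≤ volume (Set.Icc 0 (sig ρ (-(α * k)))) + volume (Set.Icc (sig ρ (α * k)) 1) :=
          measure_union_le _ _
      _ = ENNReal.ofReal (2 * sig ρ (-(α * k))) := by
          rw [Real.volume_Icc, Real.volume_Icc, ← sig_neg hρ, sub_zero,
            ← ENNReal.ofReal_add (sig_pos hρ _).le (sig_pos hρ _).le, two_mul]
      _ ≤ _ := ENNReal.ofReal_le_ofReal (by linarith)
  have hsum : ∑' k : ℕ, μ {ω | V k u ω ∉ Set.Ico (sig ρ (-(α * k))) (sig ρ (α * k))} ≠ ⊤ := by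
    refine ne_top_of_le_ne_top ?_ (ENNReal.tsum_le_tsum hbound)
    exact ((summable_geometric_of_lt_one (by positivity) hlt).mul_left 2).tsum_ofReal_ne_top
  filter_upwards [ae_eventually_notMem hsum] with ω hω
  filter_upwards [hω] with k hk
  simpa using hk

/-- Almost surely there are times at which a block of steps driving the total excess away from
`0` is followed by few bad steps in each urn. -/
theorem ae_exists_block [IsProbabilityMeasure μ] (h : IsDriving μ p X V) (hp : 0 < p) {ρ : ℝ}
    (hρ : 1 < ρ) {K m L : ℕ} {r : ℝ} (hr : 1 - p * (1 - 2 * sig ρ (-K)) < r)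
    (hL : U * (Real.exp (-(4 * (r - (1 - p * (1 - 2 * sig ρ (-K)))) * L)) *
      (1 - Real.exp (-(2 * (r - (1 - p * (1 - 2 * sig ρ (-K)))) ^ 2)))⁻¹) ≤ 1 / 2) :
    ∀ᵐ ω ∂μ, ∃ n,
      (∀ j < m, ∀ u, X (n + j) u ω = 1 ∧
        V (n + j) u ω ∈ Set.Ioo (sig ρ (-(K + 1 : ℝ))) (sig ρ (-(K : ℝ)))) ∧
      ∀ u (k : ℕ), ∑ j ∈ Finset.range k,
        badStep ρ K (X (n + m + j) u ω, V (n + m + j) u ω) ≤ r * k + L := by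
  set ξ : ℕ × Fin U → Ω → ℤ × ℝ := fun k ω => (X k.1 k.2 ω, V k.1 k.2 ω) with hξ
  set s : ℕ × Fin U → MeasurableSpace Ω := fun k => MeasurableSpace.comap (ξ k) inferInstance
  have hle : ∀ k, s k ≤ mΩ := fun k => (h.measurable_pair k).comap_le
  have hind : iIndep s μ := (iIndepFun_iff_iIndep _ _ _).1 h.iIndepFun_pair
  have hsm : ∀ (T : Set (ℕ × Fin U)) k, k ∈ T → Measurable[⨆ k ∈ T, s k] (ξ k) := fun T k hk =>
    (comap_measurable (ξ k)).mono (le_iSup₂_of_le k hk le_rfl) le_rfl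
  set A : Set (ℤ × ℝ) := {1} ×ˢ Set.Ioo (sig ρ (-(K + 1 : ℝ))) (sig ρ (-(K : ℝ))) with hA
  have hAm : MeasurableSet A := (measurableSet_singleton _).prod measurableSet_Ioo
  set B : ℕ → Set Ω := fun n => ⋂ k ∈ Finset.Ico n (n + m) ×ˢ (Finset.univ : Finset (Fin U)),
    ξ k ⁻¹' A with hB
  set W : ℕ → Set Ω := fun n => {ω | ∀ u (k : ℕ), ∑ j ∈ Finset.range k,
    badStep ρ K (ξ (n + j, u) ω) ≤ r * k + L} with hW
  have hBm : ∀ n, MeasurableSet[⨆ k ∈ {k : ℕ × Fin U | n ≤ k.1 ∧ k.1 < n + m}, s k] (B n) := by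
    intro n
    refine Finset.measurableSet_biInter _ fun k hk => hsm _ k ?_ hAm
    simpa using hk
  have hWm : ∀ n, MeasurableSet[⨆ k ∈ {k : ℕ × Fin U | n ≤ k.1}, s k] (W n) := by
    intro n
    simp only [hW, Set.ofPred_forall]
    refine MeasurableSet.iInter fun u => MeasurableSet.iInter fun k => ?_
    refine measurableSet_le ?_ measurable_const
    exact Finset.measurable_fun_sum _ fun j _ =>
      (measurable_badStep ρ K).comp (hsm _ (n + j, u) (by simp))
  -- Union bound over the U urns; `hL` makes the total failure probability at most 1/2.
  have hWle : ∀ n, 1 / 2 ≤ μ (W n) := by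
    intro n
    have hWm' : MeasurableSet (W n) := (iSup₂_le fun k _ => hle k) _ (hWm n)
    have hcompl : μ (W n)ᶜ ≤ 1 / 2 := by
      have hsub : (W n)ᶜ ⊆ ⋃ u, {ω | ∃ k : ℕ, r * k + L < ∑ j ∈ Finset.range k,
          badStep ρ K (ξ (n + j, u) ω)} := by
        intro ω hω
        simpa [hW] using hω
      calc μ (W n)ᶜ ≤ _ := measure_mono hsub
        _ ≤ ∑ u, μ {ω | ∃ k : ℕ, r * k + L < ∑ j ∈ Finset.range k,
          badStep ρ K (ξ (n + j, u) ω)} := measure_iUnion_fintype_le _ _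
        _ ≤ ∑ u : Fin U, ENNReal.ofReal
            (Real.exp (-(4 * (r - (1 - p * (1 - 2 * sig ρ (-K)))) * L)) *
            (1 - Real.exp (-(2 * (r - (1 - p * (1 - 2 * sig ρ (-K)))) ^ 2)))⁻¹) := by
          refine Finset.sum_le_sum fun u _ => ?_
          refine measure_exists_lt_sum_le (Y := fun j ω => badStep ρ K (ξ (n + j, u) ω))
            ?_ (fun j => (measurable_badStep ρ K).comp (h.measurable_pair _))
            (fun j ω => badStep_mem_Icc _ _ _)
            (fun j => h.integral_badStep hp.le hρ K.cast_nonneg (n + j, u)) hr L.cast_nonneg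
          refine (h.iIndepFun_pair.precomp (g := fun j => (n + j, u)) ?_).comp
            (fun _ => badStep ρ K) fun _ => measurable_badStep ρ K
          intro i j hij
          simpa using hij
        _ ≤ 1 / 2 := by
          rw [Finset.sum_const, Finset.card_univ, Fintype.card_fin, nsmul_eq_mul,
            ← ENNReal.ofReal_natCast, ← ENNReal.ofReal_mul (by positivity)]
          refine (ENNReal.ofReal_le_ofReal hL).trans_eq ?_
          rw [ENNReal.ofReal_div_of_pos two_pos]
          simp
    have h1 : (1 : ENNReal) = μ (W n) + μ (W n)ᶜ := (prob_add_prob_compl hWm').symm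
    have h2 : (1 : ENNReal) / 2 + 1 / 2 ≤ μ (W n) + 1 / 2 := by
      rw [ENNReal.add_halves]
      exact h1.trans_le (by gcongr)
    exact (ENNReal.add_le_add_iff_right (by simp)).1 h2
  set c₀ : ENNReal := ENNReal.ofReal p *
    ENNReal.ofReal (sig ρ (-(K : ℝ)) - sig ρ (-(K + 1 : ℝ))) with hc₀
  have hc₀0 : c₀ ≠ 0 := by
    have : sig ρ (-(K + 1 : ℝ)) < sig ρ (-(K : ℝ)) := sig_strictMono hρ (by linarith)
    exact mul_ne_zero (ENNReal.ofReal_pos.2 hp).ne' (ENNReal.ofReal_pos.2 (sub_pos.2 this)).ne'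
  have hBeq : ∀ n, μ (B n) = c₀ ^ (m * U) := by
    intro n
    rw [hB, h.iIndepFun_pair.measure_inter_preimage_eq_mul _ fun _ _ => hAm,
      Finset.prod_congr rfl fun k _ => h.measure_pair k (sig_pos hρ _).le (sig_lt_one hρ _).le]
    simp [hc₀]
  -- The block uses times in [n, n + m) and the line bound later times, so the two events are
  -- independent; their joint probability has a lower bound free of n.
  have hE := ae_frequently_of_future hle hind (E := fun n => B n ∩ W (n + m))
    (c := c₀ ^ (m * U) * (1 / 2)) (fun n => ?_)
    (by simp [hc₀0]) (fun n => ?_)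
  · filter_upwards [hE] with ω hω
    obtain ⟨n, hn1, hn2⟩ := hω.exists
    refine ⟨n, fun j hj u => ?_, hn2⟩
    have := Set.mem_iInter₂.1 hn1 (n + j, u) (by simp [hj])
    exact this
  · refine MeasurableSet.inter ?_ ?_
    · exact (biSup_mono fun k hk => hk.1 :
        (⨆ k ∈ {k : ℕ × Fin U | n ≤ k.1 ∧ k.1 < n + m}, s k) ≤ ⨆ k, ⨆ (_ : n ≤ k.1), s k) _ (hBm n)
    · exact (biSup_mono fun k hk => le_trans (Nat.le_add_right n m) hk :
        (⨆ k ∈ {k : ℕ × Fin U | n + m ≤ k.1}, s k) ≤ ⨆ k, ⨆ (_ : n ≤ k.1), s k) _ (hWm (n + m))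
  · have hdisj : Disjoint {k : ℕ × Fin U | n ≤ k.1 ∧ k.1 < n + m} {k | n + m ≤ k.1} :=
      Set.disjoint_left.2 fun k hk hk' => absurd hk.2 (not_lt.2 hk')
    have := (Indep_iff _ _ _).1 (indep_iSup_of_disjoint hle hind hdisj) _ _ (hBm n) (hWm (n + m))
    rw [this, hBeq]
    gcongr
    exact hWle _

end IsDriving

end InteractingUrns

/-! ### Choice of the constants and conclusion. -/

open InteractingUrns in
theorem theorem3p2 {Ω : Type*} [MeasurableSpace Ω] (μ : MeasureTheory.Measure Ω)
    [MeasureTheory.IsProbabilityMeasure μ] (U : ℕ) (ρ p : ℝ) (hρ : 1 < ρ)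
    (hp : 1 / 2 < p) (hp1 : p ≤ 1)
    (X : ℕ → Fin U → Ω → ℤ) (V : ℕ → Fin U → Ω → ℝ)
    (hXV : InteractingUrns.IsDriving μ p X V) :
    ∀ᵐ ω ∂μ, ∃ n₀ : ℕ, 1 ≤ n₀ ∧ ∃ d : InteractingUrns.Colour, ∀ n, n₀ ≤ n → ∀ u : Fin U,
      InteractingUrns.colour (InteractingUrns.ium (fun i => ρ ^ i) X V ω) n u = d := by
  rcases Nat.eq_zero_or_pos U with rfl | hU
  · exact ae_of_all _ fun ω => ⟨1, le_rfl, Colour.black, fun n _ u => u.elim0⟩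
  have hρ0 := zero_lt_one.trans hρ
  have hp0 : 0 < p := by linarith
  obtain ⟨K, hK⟩ : ∃ K : ℕ, 1 - p * (1 - 2 * sig ρ (-K)) < 1 / 2 := by
    -- The requirement is 2p `sig ρ (-K)` < p - 1/2; as p ≤ 1, a value of `sig ρ (-K)` below (p -
    -- 1/2)/2 suffices.
    obtain ⟨K, hK⟩ := exists_pow_lt_of_lt_one (show 0 < (p - 1 / 2) / 2 by linarith)
      (inv_lt_one_of_one_lt₀ hρ)
    refine ⟨K, ?_⟩
    have h1 := sig_neg_le hρ K
    rw [Real.rpow_neg hρ0.le, Real.rpow_natCast, ← inv_pow] at h1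
    have h2 := sig_pos hρ (-(K : ℝ))
    nlinarith
  -- The slope r exceeds the bad-step probability, so the line bound can hold, and is below 1/2, so
  -- the drift 1 - 2r is positive and leaves room for α.
  obtain ⟨r, hr1, hr2⟩ := exists_between hK
  obtain ⟨α, hα1, hα2⟩ := exists_between (show 0 < 1 - 2 * r by linarith)
  set δ := r - (1 - p * (1 - 2 * sig ρ (-K))) with hδ
  have hδ0 : 0 < δ := sub_pos.2 hr1
  obtain ⟨L, hL⟩ : ∃ L : ℕ, U * (Real.exp (-(4 * δ * L)) *
      (1 - Real.exp (-(2 * δ ^ 2)))⁻¹) ≤ 1 / 2 := by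
    have h1 : Tendsto (fun L : ℕ => 4 * δ * (L : ℝ)) atTop atTop :=
      tendsto_natCast_atTop_atTop.const_mul_atTop (by linarith)
    have h2 := ((Real.tendsto_exp_neg_atTop_nhds_zero.comp h1).mul_const
      (1 - Real.exp (-(2 * δ ^ 2)))⁻¹).const_mul (U : ℝ)
    rw [zero_mul, mul_zero] at h2
    exact (h2.eventually_le_const (by norm_num)).exists
  filter_upwards [hXV.ae_exists_block hp0 hρ (m := 2 * K + 2 * U * L) hr1 hL,
    hXV.ae_eventually_mem_Ico hρ hα1] with ω ⟨n, hblock, hwalk⟩ hev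
  exact exists_colour_of_block_of_sum_le hρ hU hr2 hα1.le hα2 rfl hblock hwalk hev
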